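/- Let $\mathbb K$ be a (possibly infinite) field of characteristic $3$ with a Tits endomorphism $\theta$, i.e. a field endomorphism with $\theta(\theta(x))=x^3$ for all $x$. Let $\Xi$ be the group of columns $(a,b,c)\in\mathbb K^3$ with $$(a,b,c)*(x,y,z)=(a+x,\;b+y+ax^\theta,\;ay-bx+c+z-ax^{\theta+1}),$$ let $P=\Xi\cup\{\infty\}$, on which $\Xi$ acts by right multiplication (fixing $\infty$), and let $\omega$ be the involutory permutation of $P$ that swaps $\infty$ and $o=(0,0,0)$ and maps every other point as follows: $$(a,b,c)^\omega=\tfrac{-1}{N(a,b,c)}\bigl(a^\theta b^\theta-c^\theta+ab^2+bc-a^{2\theta+3},\;a^2b-ac+b^\theta-a^{\theta+3},\;c\bigr),$$ $$N(a,b,c)=-ac^\theta+a^{\theta+1}b^\theta-a^{\theta+3}b-a^2b^2+b^{\theta+1}+c^2-a^{2\theta+4}.$$ The Ree group $R(\mathbb K,\theta)\le\mathrm{Sym}(P)$ is generated by $\omega$ and $\Xi$. The Ree–Tits unital $RT(\mathbb K,\theta)$ has point set $P$, and its blocks are the non-empty fixed point sets $\mathrm{Fix}\,g$ of involutions $g\in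 R(\mathbb K,\theta)$; write $RT(3)$ for $\mathbb K=\mathbb F_3$, $\theta=\mathrm{id}$. A super O'Nan configuration consists of ten points and five blocks whose incidences form the dual of the complete graph $K_5$ (points correspond to edges, blocks to vertices). Permutations act from the right, products are read from left to right, and $g^h=h^{-1}gh$. Put $\sigma\colon(a,b,c)\mapsto(-a,b,-c)$ (fixing $\infty$), $\zeta=(0,0,1)$, $\tau=\sigma\zeta$, $\lambda_t=(0,t,0)$, $\Lambda=\{\lambda_t\mid t\in\mathbb K\}$, $\lambda=\lambda_1$, $\alpha=(-1,0,1)$, $\iota=(\omega\alpha)\,\omega\,(\omega\alpha)^{-1}$, and consider the points $\varepsilon=(0,0,-1)$ and $\psi=(-1,-1,1)$. Let $\mathcal S$ consist of the points $\infty,\ \varepsilon^{\lambda^i},\ \varepsilon^{\sigma\lambda^i},\ \psi^{\lambda^i}$ and the sets $\mathrm{Fix}\,\tau,\ \mathrm{Fix}\,\tau^\sigma,\ \mathrm{Fix}\,\iota^{\lambda^i}$, where $i\in\{0,1,2\}$. Here exponents on points denote images under permutations. (1) In $RT(3)$ we have $\mathrm{Fix}\,\omega=\{(0,1,1),(0,1,-1),(1,1,0),(-1,1,0)\}$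 and $\mathrm{Fix}\,\iota=\{\varepsilon,\varepsilon^{\sigma\lambda},\psi,\psi^\lambda\}$, and $\mathcal S$ is a super O'Nan configuration. (2) In $RT(\mathbb K,\theta)$, for arbitrary $\mathbb K$ and $\theta$, the set $\mathrm{Fix}\,\iota$ contains $\varepsilon$ and $\varepsilon^{\sigma\lambda}$. Each element of $\Lambda$ leaves $\mathrm{Fix}\,\sigma$, $\mathrm{Fix}\,\tau$ and $\mathrm{Fix}\,\tau^\sigma$ invariant, and $\mathrm{Fix}\,\tau\cap\mathrm{Fix}\,\tau^\sigma=\{\infty\}$. Every translate $\mathcal S^{\lambda_t}$ with $t\in\mathbb K$ (including $\mathcal S$ itself) is a super O'Nan configuration containing the blocks $\mathrm{Fix}\,\tau$, $\mathrm{Fix}\,\tau^\sigma$ and the point $\infty$. Two different translates have exactly these two blocks and this one point in common. The number of different translates is $|\mathbb K|/3$, in the sense that three times their cardinality equals the cardinality of $\mathbb K$. (3) If $\mathbb K$ is finite of order $q$, then the union of these $q/3$ configurations has exactly $3q+1$ points and $q+2$ blocks. -/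

import Mathlib

namespace ReeTits

section

variable {K : Type*} [Field K]

/-- A Tits endomorphism of `K` (of characteristic 3): its square is the Frobenius endomorphism. -/
def IsTits (θ : K →+* K) : Prop := ∀ x, θ (θ x) = x ^ 3

lemma isTits_id : IsTits (RingHom.id (ZMod 3)) := by
  intro x
  exact (ZMod.pow_card x).symm

/-- The root group `Ξ = U(K, θ)`, the set of columns `(a, b, c)` with entries in `K`. -/
@[ext]
structure Xi (θ : K →+* K) where
  a : K
  b : K
  c : K

namespace Xi

variable {θ : K →+* K}

instance : Mul (Xi θ) :=
  ⟨fun p r => ⟨p.a + r.a, p.b + r.b + p.a * θ r.a,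
    p.a * r.b - p.b * r.a + p.c + r.c - p.a * (θ r.a * r.a)⟩⟩

instance : One (Xi θ) := ⟨⟨0, 0, 0⟩⟩

instance : Inv (Xi θ) := ⟨fun p => ⟨-p.a, θ p.a * p.a - p.b, -p.c⟩⟩

lemma mul_def (p r : Xi θ) : p * r = ⟨p.a + r.a, p.b + r.b + p.a * θ r.a,
    p.a * r.b - p.b * r.a + p.c + r.c - p.a * (θ r.a * r.a)⟩ := rfl

lemma one_def : (1 : Xi θ) = ⟨0, 0, 0⟩ := rfl

lemma inv_def (p : Xi θ) : p⁻¹ = ⟨-p.a, θ p.a * p.a - p.b, -p.c⟩ := rfl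

instance : Group (Xi θ) :=
  Group.ofLeftAxioms
    (by intro p r s; ext <;> simp [mul_def] <;> ring)
    (by intro p; ext <;> simp [mul_def, one_def])
    (by intro p; ext <;> simp [mul_def, one_def, inv_def] <;> ring)

/-- The norm `N(a, b, c)`. -/
def N (x : Xi θ) : K :=
  -(x.a * θ x.c) + θ x.a * x.a * θ x.b - θ x.a * x.a ^ 3 * x.b - x.a ^ 2 * x.b ^ 2
    + θ x.b * x.b + x.c ^ 2 - θ x.a ^ 2 * x.a ^ 4

/-- The first entry of the column in the definition of `ω`, before multiplication by `-1/N`. -/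
def v (x : Xi θ) : K :=
  θ x.a * θ x.b - θ x.c + x.a * x.b ^ 2 + x.b * x.c - θ x.a ^ 2 * x.a ^ 3

/-- The second entry of the column in the definition of `ω`, before multiplication by `-1/N`. -/
def u (x : Xi θ) : K :=
  x.a ^ 2 * x.b - x.a * x.c + θ x.b - θ x.a * x.a ^ 3

/-- The effect of `ω` on the non-trivial elements of `Ξ`. -/
def om (x : Xi θ) : Xi θ := ⟨-1 / N x * v x, -1 / N x * u x, -1 / N x * x.c⟩

lemma N_eq [CharP K 3] (x : Xi θ) : N x = x.a * v x + x.b * u x + x.c ^ 2 := by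
  simp only [N, v, u]
  grind

lemma aux_no_zero [CharP K 3] (b c B C : K) (hc : C = 0 → c = 0) (hB : B = 0 → b = 0)
    (hB1 : B = 1 → b = 1) (hcc : C = B ^ 2 - B → c = b ^ 2 - b)
    (h1 : C = B + b ^ 2 + b * c - 1) (h2 : c ^ 3 = b ^ 3 + B ^ 2 + B * C - 1)
    (h3 : c ^ 2 = -b * (b - c + B - 1)) (h4 : C ^ 2 = -B * (B - C + b ^ 3 - 1)) : False := by
  have key : C * (C - (B ^ 2 - B)) = 0 := by grind (ringSteps := 100000)
  have hC : C = 0 := by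
    rcases mul_eq_zero.1 key with h | h
    · exact h
    · have hC' : C = B ^ 2 - B := sub_eq_zero.1 h
      have hc' := hcc hC'
      have : C ^ 2 = 0 := by
        clear hc hB hB1 hcc key
        grind (ringSteps := 100000)
      exact pow_eq_zero_iff (two_ne_zero) |>.1 this
  have hc0 := hc hC
  subst hC hc0
  have hBB : B * (B - 1) = 0 := by
    clear hc hB hB1 hcc key
    grind (ringSteps := 100000)
  rcases mul_eq_zero.1 hBB with h | h
  · have := hB h
    grind
  · have h' : B = 1 := sub_eq_zero.1 h
    have := hB1 h'
    grind

lemma identityI [CharP K 3] (hθ : IsTits θ) (x : Xi θ) :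
    v x ^ 2 * u x * θ (N x) + v x * x.c * N x * θ (N x) + θ (u x) * N x ^ 3 + θ (v x) * v x ^ 3
      = x.b * N x ^ 2 * θ (N x) := by
  obtain ⟨a, b, c⟩ := x
  simp only [N, v, u, map_add, map_sub, map_mul, map_pow, map_neg, hθ a, hθ b, hθ c]
  generalize θ a = A
  generalize θ b = B
  generalize θ c = C
  grind (ringSteps := 100000)

lemma identityII [CharP K 3] (hθ : IsTits θ) (x : Xi θ) :
    θ (v x) * θ (u x) * N x ^ 3 + θ x.c * N x ^ 3 * θ (N x) - v x * u x ^ 2 * θ (N x) ^ 2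
      + u x * x.c * N x * θ (N x) ^ 2 + θ (v x) ^ 2 * v x ^ 3
      = -x.a * N x ^ 2 * θ (N x) ^ 2 := by
  obtain ⟨a, b, c⟩ := x
  simp only [N, v, u, map_add, map_sub, map_mul, map_pow, map_neg, hθ a, hθ b, hθ c]
  generalize θ a = A
  generalize θ b = B
  generalize θ c = C
  grind (ringSteps := 100000)

/-- The norm is anisotropic. -/
lemma N_ne_zero [CharP K 3] (hθ : IsTits θ) {x : Xi θ} (hx : x ≠ 1) : N x ≠ 0 := by
  intro hN
  have hv : v x = 0 := by
    have h := identityI hθ x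
    rw [hN] at h
    have h' : θ (v x) * v x ^ 3 = 0 := by simpa using h
    rcases mul_eq_zero.1 h' with h1 | h1
    · exact (map_eq_zero θ).1 h1
    · exact (pow_eq_zero_iff (by norm_num)).1 h1
  have hN' : x.b * u x + x.c ^ 2 = 0 := by
    have := N_eq x
    rw [hN, hv] at this
    simpa using this.symm
  obtain ⟨a, b, c⟩ := x
  have hV := congrArg θ hv
  have hU := congrArg θ hN'
  simp only [v, u, map_add, map_sub, map_mul, map_pow, map_zero, hθ a, hθ b, hθ c] at hv hN' hV hU
  by_cases ha : a = 0
  · subst ha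
    simp only [map_zero] at hv hN' hV hU
    have hc : c ^ 3 = -c ^ 3 := by grind
    have hc0 : c = 0 := by
      have : c ^ 3 = 0 := by grind
      exact (pow_eq_zero_iff (by norm_num)).1 this
    subst hc0
    have hb : b * θ b = 0 := by
      simpa using hN'
    have hb0 : b = 0 := by
      rcases mul_eq_zero.1 hb with h | h
      · exact h
      · exact (map_eq_zero θ).1 h
    subst hb0
    exact hx rfl
  · have hA : θ a ≠ 0 := (map_ne_zero θ).2 ha
    obtain ⟨t, ht⟩ : ∃ t, b = t * (a * θ a) := ⟨b / (a * θ a), by field_simp⟩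
    obtain ⟨s, hs⟩ : ∃ s, c = s * (a ^ 2 * θ a) := ⟨c / (a ^ 2 * θ a), by field_simp⟩
    have hB : θ b = θ t * (θ a * a ^ 3) := by rw [ht]; simp [hθ a]
    have hC : θ c = θ s * (θ a ^ 2 * a ^ 3) := by rw [hs]; simp [hθ a]
    rw [hB, hC] at hV hU
    rw [hB] at hN'
    rw [hB, hC] at hv
    subst ht hs
    refine aux_no_zero t s (θ t) (θ s) (fun h => (map_eq_zero θ).1 h)
      (fun h => (map_eq_zero θ).1 h) (fun h => θ.injective (by simpa using h))
      (fun h => θ.injective (by simpa using h)) ?_ ?_ ?_ ?_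
    · have : (θ a ^ 2 * a ^ 3) * (θ s - (θ t + t ^ 2 + t * s - 1)) = 0 := by
        linear_combination -hv
      rcases mul_eq_zero.1 this with h | h
      · exact absurd h (mul_ne_zero (pow_ne_zero _ hA) (pow_ne_zero _ ha))
      · exact sub_eq_zero.1 h
    · have : (θ a ^ 3 * a ^ 6) * (s ^ 3 - (t ^ 3 + θ t ^ 2 + θ t * θ s - 1)) = 0 := by
        linear_combination -hV
      rcases mul_eq_zero.1 this with h | h
      · exact absurd h (mul_ne_zero (pow_ne_zero _ hA) (pow_ne_zero _ ha))
      · exact sub_eq_zero.1 h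
    · have : (θ a ^ 2 * a ^ 4) * (s ^ 2 - (-t * (t - s + θ t - 1))) = 0 := by
        linear_combination hN'
      rcases mul_eq_zero.1 this with h | h
      · exact absurd h (mul_ne_zero (pow_ne_zero _ hA) (pow_ne_zero _ ha))
      · exact sub_eq_zero.1 h
    · have : (θ a ^ 4 * a ^ 6) * (θ s ^ 2 - (-θ t * (θ t - θ s + t ^ 3 - 1))) = 0 := by
        linear_combination hU
      rcases mul_eq_zero.1 this with h | h
      · exact absurd h (mul_ne_zero (pow_ne_zero _ hA) (pow_ne_zero _ ha))
      · exact sub_eq_zero.1 h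

lemma om_ne_one [CharP K 3] (hθ : IsTits θ) {x : Xi θ} (hx : x ≠ 1) : om x ≠ 1 := by
  intro h
  have hN := N_ne_zero hθ hx
  have h1 := congrArg Xi.a h
  have h2 := congrArg Xi.b h
  have h3 := congrArg Xi.c h
  simp only [om, one_def, mul_eq_zero, div_eq_zero_iff, neg_eq_zero, one_ne_zero, hN,
    false_or] at h1 h2 h3
  apply hN
  rw [N_eq, h1, h2, h3]
  ring

lemma v_om [CharP K 3] (hθ : IsTits θ) {x : Xi θ} (hx : x ≠ 1) :
    v (om x) = -x.a / N x := by
  have hN := N_ne_zero hθ hx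
  have hT : θ (N x) ≠ 0 := (map_ne_zero θ).2 hN
  have h := identityII hθ x
  have e : v (om x) = (θ (v x) * θ (u x) * N x ^ 3 + θ x.c * N x ^ 3 * θ (N x)
      - v x * u x ^ 2 * θ (N x) ^ 2
      + u x * x.c * N x * θ (N x) ^ 2 + θ (v x) ^ 2 * v x ^ 3) / (N x ^ 3 * θ (N x) ^ 2) := by
    rw [v, om]
    simp only [map_mul, map_div₀, map_neg, map_one]
    field_simp
    ring
  rw [e, h]
  field_simp

lemma u_om [CharP K 3] (hθ : IsTits θ) {x : Xi θ} (hx : x ≠ 1) :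
    u (om x) = -x.b / N x := by
  have hN := N_ne_zero hθ hx
  have hT : θ (N x) ≠ 0 := (map_ne_zero θ).2 hN
  have h := identityI hθ x
  have e : u (om x) = -(v x ^ 2 * u x * θ (N x) + v x * x.c * N x * θ (N x)
      + θ (u x) * N x ^ 3 + θ (v x) * v x ^ 3) / (N x ^ 3 * θ (N x)) := by
    rw [u, om]
    simp only [map_mul, map_div₀, map_neg, map_one]
    field_simp
    ring
  rw [e, h]
  field_simp

lemma om_om [CharP K 3] (hθ : IsTits θ) {x : Xi θ} (hx : x ≠ 1) : om (om x) = x := by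
  have hN := N_ne_zero hθ hx
  have hN' : N (om x) = 1 / N x := by
    have e : N (om x) = (x.a * v x + x.b * u x + x.c ^ 2) / N x ^ 2 := by
      rw [N_eq, v_om hθ hx, u_om hθ hx]
      simp only [om]
      field_simp
    rw [e, ← N_eq]
    field_simp
  have h : om (om x) = ⟨-1 / N (om x) * v (om x), -1 / N (om x) * u (om x),
      -1 / N (om x) * (-1 / N x * x.c)⟩ := rfl
  rw [h, hN', v_om hθ hx, u_om hθ hx]
  ext <;> field_simp

end Xi

/-- The point set `P = Ξ ∪ {∞}`; the point `∞` is `none`. -/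
abbrev Point (θ : K →+* K) := Option (Xi θ)

variable {θ : K →+* K}

/-- Right multiplication by `ξ`, as a permutation of `P` fixing `∞`. -/
def transl (ξ : Xi θ) : Equiv.Perm (Point θ) := Equiv.optionCongr (Equiv.mulRight ξ)

open Classical in
/-- The map `ω` on `P`: it interchanges `∞` and `o = (0, 0, 0)`. -/
noncomputable def omegaFun : Point θ → Point θ
  | none => some 1
  | some x => if x = 1 then none else some (Xi.om x)

lemma omegaFun_involutive [CharP K 3] (hθ : IsTits θ) :
    Function.Involutive (omegaFun (θ := θ)) := by
  intro p
  rcases p with _ | x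
  · simp [omegaFun]
  · by_cases hx : x = 1
    · simp [omegaFun, hx]
    · simp [omegaFun, hx, Xi.om_ne_one hθ hx, Xi.om_om hθ hx]

/-- `ω` as a permutation of `P`. -/
noncomputable def omega [CharP K 3] (hθ : IsTits θ) : Equiv.Perm (Point θ) :=
  (omegaFun_involutive hθ).toPerm omegaFun

/-- The permutation `η_s` of `P`: `(a, b, c) ↦ (s a, s^(θ+1) b, s^(θ+2) c)`, fixing `∞`. -/
def eta (θ : K →+* K) (s : Kˣ) : Equiv.Perm (Point θ) :=
  Equiv.optionCongr
    { toFun := fun x => ⟨s * x.a, θ s * s * x.b, θ s * s ^ 2 * x.c⟩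
      invFun := fun x => ⟨(s : K)⁻¹ * x.a, (θ s * s)⁻¹ * x.b, (θ s * s ^ 2)⁻¹ * x.c⟩
      left_inv := by
        intro x
        have h : θ (s : K) ≠ 0 := (map_ne_zero θ).2 s.ne_zero
        ext <;> simp <;> field_simp
      right_inv := by
        intro x
        have h : θ (s : K) ≠ 0 := (map_ne_zero θ).2 s.ne_zero
        ext <;> simp <;> field_simp }

/-- The Ree group `R(K, θ)`. -/
def Ree [CharP K 3] (hθ : IsTits θ) : Subgroup (Equiv.Perm (Point θ)) :=
  Subgroup.closure ({omega hθ} ∪ Set.range transl)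

/-- The fixed point set of a permutation. -/
def Fix {P : Type*} (g : Equiv.Perm P) : Set P := Function.fixedPoints g

/-- The block set of the Ree-Tits unital `RT(K, θ)`, whose point set is `Point θ`:
the non-empty fixed point sets of involutions in the Ree group. -/
def unitalBlocks [CharP K 3] (hθ : IsTits θ) : Set (Set (Point θ)) :=
  {B | B.Nonempty ∧ ∃ g ∈ Ree hθ, orderOf g = 2 ∧ B = Fix g}

/-- A set of points together with a set of blocks (viewed as point sets). -/
@[ext]
structure Config (P : Type*) where
  points : Set P
  blocks : Set (Set P)

/-- The image of a configuration under a permutation of the ambient point set. -/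
def Config.map {P : Type*} (g : Equiv.Perm P) (C : Config P) : Config P :=
  ⟨g '' C.points, (fun B => g '' B) '' C.blocks⟩

/-- A super O'Nan configuration in the incidence structure with block set `𝓑`: a configuration
of points and blocks that is dual to the complete graph on five vertices, i.e. its
points correspond to the edges and its blocks to the vertices of that graph, such that a point
lies on a block exactly if the corresponding edge contains the corresponding vertex. -/
def IsSuperONan {P : Type*} (𝓑 : Set (Set P)) (C : Config P) : Prop :=
  C.blocks ⊆ 𝓑 ∧
    ∃ (e : C.points ≃ (⊤ : SimpleGraph (Fin 5)).edgeSet) (f : C.blocks ≃ Fin 5),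
      ∀ (p : C.points) (B : C.blocks), (p : P) ∈ (B : Set P) ↔ f B ∈ (e p : Sym2 (Fin 5))

/-!
Permutations act from the right in the classical notation of this subject, so that a product
`g h` there means `g` first, and `g ^ h` is `h⁻¹ g h`. In Lean `g * h` applies `h` first;
all products below are therefore written in reverse order.
-/

/-- The conjugate `g ^ h` (right action convention): first `h⁻¹`, then `g`, then `h`. -/
def conjBy {P : Type*} (g h : Equiv.Perm P) : Equiv.Perm P := h * g * h⁻¹

/-- `σ = η_{-1}`. -/
def sigma (θ : K →+* K) : Equiv.Perm (Point θ) := eta θ (-1)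

/-- `ζ = (0, 0, 1)`. -/
def zeta (θ : K →+* K) : Xi θ := ⟨0, 0, 1⟩

/-- `τ = σ ζ`: first `σ`, then `ζ`. -/
def tau (θ : K →+* K) : Equiv.Perm (Point θ) := transl (zeta θ) * sigma θ

/-- `τ ^ σ`. -/
def tauSigma (θ : K →+* K) : Equiv.Perm (Point θ) := conjBy (tau θ) (sigma θ)

/-- `λ_t = (0, t, 0)`; these are the elements of the group `Λ`. -/
def lam (θ : K →+* K) (t : K) : Xi θ := ⟨0, t, 0⟩

/-- `α = (-1, 0, 1)`. -/
def alpha (θ : K →+* K) : Xi θ := ⟨-1, 0, 1⟩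

/-- `ι = (ω α) ω (ω α)⁻¹`: first `ω`, then `α`, then `ω`, then `α⁻¹`, then `ω⁻¹`. -/
noncomputable def iota [CharP K 3] (hθ : IsTits θ) : Equiv.Perm (Point θ) :=
  (transl (alpha θ) * omega hθ)⁻¹ * omega hθ * (transl (alpha θ) * omega hθ)

/-- The point `ε = ζ⁻¹ = (0, 0, -1)`. -/
def eps (θ : K →+* K) : Point θ := some (zeta θ)⁻¹

/-- The point `ψ = (-1, -1, 1)`. -/
def psi (θ : K →+* K) : Point θ := some ⟨-1, -1, 1⟩

/-- The configuration `𝒮` with points `∞`, `ε^(λ^i)`, `ε^(σ λ^i)`, `ψ^(λ^i)` and blocks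
`Fix τ`, `Fix τ^σ`, `Fix ι^(λ^i)`, where `λ = λ_1 = (0, 1, 0)` and `i = 0, 1, 2`. -/
noncomputable def pearl [CharP K 3] (hθ : IsTits θ) : Config (Point θ) where
  points := {none}
    ∪ Set.range (fun i : Fin 3 => (transl (lam θ 1) ^ (i : ℕ)) (eps θ))
    ∪ Set.range (fun i : Fin 3 => (transl (lam θ 1) ^ (i : ℕ)) (sigma θ (eps θ)))
    ∪ Set.range (fun i : Fin 3 => (transl (lam θ 1) ^ (i : ℕ)) (psi θ))
  blocks := {Fix (tau θ), Fix (tauSigma θ)}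
    ∪ Set.range (fun i : Fin 3 => Fix (conjBy (iota hθ) (transl (lam θ 1) ^ (i : ℕ))))

/-- The set of all translates of `𝒮` under the group `Λ`. -/
def pearls [CharP K 3] (hθ : IsTits θ) : Set (Config (Point θ)) :=
  Set.range (fun t : K => (pearl hθ).map (transl (lam θ t)))

end

end ReeTits

/-! The map (a, b, c) ↦ (1 : a : b : c : u : v : N), with ∞ ↦ (0 : … : 0 : 1), embeds `P` into
projective 6-space. There `ω` and the translations by columns over the prime field act linearly, by
matrices over F_3 that do not depend on `K` and `θ`. Hence identities between words in these
permutations become finite matrix computations. This shows that `σ`, and with it `τ`, lies in the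
Ree group (`sigma_eq`), and yields a matrix for `ι` (`isInducedBy_iota`). Fixed points are then
eigenvectors.

Solving the eigenvector equations on the Λ-orbits of ε, ε^σ and ψ, with orbit parameter s, shows
that Fix ι meets them exactly for s = 0, for s = 1 and for s ∈ {0, 1}, respectively. By translation
this determines which points of these orbits lie on which blocks Fix ι^(λ_t), t ∈ K: the points of
the first orbit join Fix τ to the block s, those of the second join Fix τ^σ to the block s - 1, and
those of the third join the blocks s and s - 1. As 3 = 0, the three blocks of a coset t + F_3 close
up to a triangle, and together with ∞ = Fix τ ∩ Fix τ^σ the dual of K_5 appears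
(`pearlOn_isSuperONan`).

A translate of 𝒮 thus depends only on a coset of F_3 in `K`. Disjointness of cosets gives the
intersections, `K` ≃ (K/F_3) × F_3 gives the number of translates, and the union over all cosets
gives the counts for finite `K`. -/

namespace ReeTits

/-! ### Linear action on projective coordinates. -/

section Coordinates

variable {K : Type*} [Field K] {θ : K →+* K}

/-- Homogeneous coordinates of the points: the embedding of `P` into the projective space of the
seven-dimensional representation of the Ree group. -/
def coords : Point θ → Fin 7 → K
  | none => ![0, 0, 0, 0, 0, 0, 1]
  | some x => ![1, x.a, x.b, x.c, x.u, x.v, x.N]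

/-- Coordinate 0 is 1 on Ξ and 0 at ∞: it separates the two cases and forces k = 1 on Ξ. -/
lemma eq_of_coords_eq_smul {p r : Point θ} {k : K} (hk : k ≠ 0)
    (h : coords p = k • coords r) : p = r := by
  rcases p with _ | x <;> rcases r with _ | y
  · rfl
  · have := congrFun h 0
    simp [coords, hk.symm] at this
  · have := congrFun h 0
    simp [coords] at this
  · have h0 := congrFun h 0
    have h1 := congrFun h 1
    have h2 := congrFun h 2
    have h3 := congrFun h 3
    simp only [coords, Pi.smul_apply, smul_eq_mul, Matrix.cons_val, mul_one] at h0 h1 h2 h3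
    subst h0
    congr 1
    ext
    · rw [h1, one_mul]
    · rw [h2, one_mul]
    · rw [h3, one_mul]

variable [CharP K 3]

/-- A matrix over the prime field, considered over `K`. -/
def liftMatrix (K : Type*) [Field K] [CharP K 3] (M : Matrix (Fin 7) (Fin 7) (ZMod 3)) :
    Matrix (Fin 7) (Fin 7) K :=
  M.map (ZMod.castHom (dvd_refl 3) K)

/-- The permutation `g` of the point set is induced by the matrix `M` on homogeneous
coordinates. -/
def IsInducedBy (g : Equiv.Perm (Point θ)) (M : Matrix (Fin 7) (Fin 7) (ZMod 3)) : Prop :=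
  ∀ p, ∃ k : K, k ≠ 0 ∧ (liftMatrix K M).mulVec (coords p) = k • coords (g p)

lemma IsInducedBy.mul {g h : Equiv.Perm (Point θ)} {M M' : Matrix (Fin 7) (Fin 7) (ZMod 3)}
    (hg : IsInducedBy g M) (hh : IsInducedBy h M') : IsInducedBy (g * h) (M * M') := by
  intro p
  obtain ⟨k, hk, h1⟩ := hh p
  obtain ⟨l, hl, h2⟩ := hg (h p)
  refine ⟨k * l, mul_ne_zero hk hl, ?_⟩
  have : liftMatrix K (M * M') = liftMatrix K M * liftMatrix K M' := Matrix.map_mul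
  rw [this, ← Matrix.mulVec_mulVec, h1, Matrix.mulVec_smul, h2, smul_smul]
  rfl

/-- This reduces an equality of two words in the generators to an equality of matrices over F_3. -/
lemma IsInducedBy.unique {g h : Equiv.Perm (Point θ)} {M : Matrix (Fin 7) (Fin 7) (ZMod 3)}
    (hg : IsInducedBy g M) (hh : IsInducedBy h M) : g = h := by
  ext1 p
  obtain ⟨k, hk, h1⟩ := hg p
  obtain ⟨l, hl, h2⟩ := hh p
  refine eq_of_coords_eq_smul (k := k⁻¹ * l) (by positivity) ?_
  rw [← smul_smul, ← h2, h1, smul_smul, inv_mul_cancel₀ hk, one_smul]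

lemma IsInducedBy.mem_fix_iff {g : Equiv.Perm (Point θ)} {M : Matrix (Fin 7) (Fin 7) (ZMod 3)}
    (hg : IsInducedBy g M) (p : Point θ) :
    p ∈ Fix g ↔ ∃ k : K, k ≠ 0 ∧ (liftMatrix K M).mulVec (coords p) = k • coords p := by
  obtain ⟨k, hk, h1⟩ := hg p
  constructor
  · intro h
    refine ⟨k, hk, ?_⟩
    rw [h1, show g p = p from h]
  · rintro ⟨l, hl, h2⟩
    refine eq_of_coords_eq_smul (k := k⁻¹ * l) (by positivity) ?_
    rw [← smul_smul, ← h2, h1, smul_smul, inv_mul_cancel₀ hk, one_smul]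

/-- The matrix inducing `ω`. -/
def omegaMatrix : Matrix (Fin 7) (Fin 7) (ZMod 3) :=
  !![0, 0, 0, 0, 0, 0, 1; 0, 0, 0, 0, 0, -1, 0; 0, 0, 0, 0, -1, 0, 0; 0, 0, 0, -1, 0, 0, 0;
    0, 0, -1, 0, 0, 0, 0; 0, -1, 0, 0, 0, 0, 0; 1, 0, 0, 0, 0, 0, 0]

/-- By `N_eq`, N = av + bu + c², and `ω` interchanges a with v and b with u up to the factor -1/N.
-/
lemma Xi.N_om (hθ : IsTits θ) {x : Xi θ} (hx : x ≠ 1) : (om x).N = 1 / N x := by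
  have hN := N_ne_zero hθ hx
  have e : N (om x) = (x.a * v x + x.b * u x + x.c ^ 2) / N x ^ 2 := by
    rw [N_eq, v_om hθ hx, u_om hθ hx]
    simp only [om]
    field_simp
  rw [e, ← N_eq]
  field_simp

lemma omega_isInducedBy (hθ : IsTits θ) : IsInducedBy (omega hθ) omegaMatrix := by
  rintro (_ | x)
  · refine ⟨1, one_ne_zero, ?_⟩
    have : omega hθ none = some 1 := rfl
    rw [this]
    ext i
    fin_cases i <;> simp [liftMatrix, omegaMatrix, coords, Matrix.mulVec, dotProduct,
      Fin.sum_univ_succ, Xi.one_def, Xi.u, Xi.v, Xi.N]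
  · by_cases hx : x = 1
    · subst hx
      refine ⟨1, one_ne_zero, ?_⟩
      have : omega hθ (some 1) = none := if_pos rfl
      rw [this]
      ext i
      fin_cases i <;> simp [liftMatrix, omegaMatrix, coords, Matrix.mulVec, dotProduct,
        Fin.sum_univ_succ, Xi.one_def, Xi.u, Xi.v, Xi.N]
    · have hN := Xi.N_ne_zero hθ hx
      refine ⟨x.N, hN, ?_⟩
      have : omega hθ (some x) = some x.om := if_neg hx
      rw [this]
      simp only [coords, Xi.N_om hθ hx, Xi.u_om hθ hx, Xi.v_om hθ hx]
      ext i
      fin_cases i <;> simp [liftMatrix, omegaMatrix, Matrix.mulVec, dotProduct,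
        Fin.sum_univ_succ, Xi.om] <;> field_simp

omit [CharP K 3] in
lemma transl_some (ξ x : Xi θ) : transl ξ (some x) = some (x * ξ) := rfl

omit [CharP K 3] in
lemma transl_none (ξ : Xi θ) : transl ξ none = none := rfl

/-- The matrix inducing right multiplication by `(x, y, z)`, for `x`, `y`, `z` in the prime
field. -/
def translMatrix (x y z : ZMod 3) : Matrix (Fin 7) (Fin 7) (ZMod 3) :=
  !![1, 0, 0, 0, 0, 0, 0;
    x, 1, 0, 0, 0, 0, 0;
    y, x, 1, 0, 0, 0, 0;
    z, y - x ^ 2, -x, 1, 0, 0, 0;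
    y - x * z - x ^ 2 + x ^ 2 * y, -z - x + x * y, -x ^ 2, -x, 1, 0, 0;
    -z + y * z - x + x * y + x * y ^ 2, -y ^ 2 + x * z + x ^ 2 * y, z + x * y, y, -x, 1, 0;
    z ^ 2 + y ^ 2 - x * z - x ^ 2 - x ^ 2 * y ^ 2, -z - y * z + x + x * y ^ 2 + x ^ 2 * z,
      y + x * z - x ^ 2 + x ^ 2 * y, -z, y - x ^ 2, x, 1]

/-- On the prime field θ is the identity and t³ = t, so the coordinates of the product become linear
in those of the given point, with coefficients in F_3. The scalar is 1 because translations preserve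
coordinate 0. -/
lemma transl_isInducedBy (x y z : ZMod 3) :
    IsInducedBy (transl (⟨ZMod.castHom (dvd_refl 3) K x, ZMod.castHom (dvd_refl 3) K y,
      ZMod.castHom (dvd_refl 3) K z⟩ : Xi θ)) (translMatrix x y z) := by
  have hmap : ∀ t : ZMod 3,
      θ (ZMod.castHom (dvd_refl 3) K t) = ZMod.castHom (dvd_refl 3) K t := fun t =>
    RingHom.congr_fun (Subsingleton.elim (θ.comp (ZMod.castHom (dvd_refl 3) K)) _) t
  have hcube : ∀ t : ZMod 3,
      ZMod.castHom (dvd_refl 3) K t ^ 3 = ZMod.castHom (dvd_refl 3) K t := fun t => by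
    rw [← map_pow, ZMod.pow_card]
  rintro (_ | p)
  · refine ⟨1, one_ne_zero, ?_⟩
    ext i
    fin_cases i <;> simp [liftMatrix, translMatrix, coords, Matrix.mulVec, dotProduct,
      Fin.sum_univ_succ, transl_none]
  · refine ⟨1, one_ne_zero, ?_⟩
    have hx := hmap x
    have hy := hmap y
    have hz := hmap z
    have hx' := hcube x
    have hy' := hcube y
    have hz' := hcube z
    rw [one_smul, transl_some]
    simp only [coords, Xi.mul_def, Xi.u, Xi.v, Xi.N, liftMatrix, translMatrix, map_add, map_sub,
      map_mul, hx, hy, hz]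
    ext i
    simp only [Matrix.mulVec, dotProduct, Fin.sum_univ_succ]
    fin_cases i <;>
    simp only [Matrix.map_apply, Matrix.of_apply, Matrix.cons_val, Fin.isValue, Fin.zero_eta,
      Fin.mk_one, Fin.reduceFinMk, Fin.succ_zero_eq_one, Fin.succ_one_eq_two, Fin.reduceSucc,
      Finset.univ_eq_empty, Finset.sum_empty, map_zero, map_one, map_neg, map_add, map_sub,
      map_mul, map_pow] <;>
    generalize ZMod.castHom (dvd_refl 3) K x = X at * <;>
    generalize ZMod.castHom (dvd_refl 3) K y = Y at * <;>
    generalize ZMod.castHom (dvd_refl 3) K z = Z at * <;>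
    generalize θ p.a = A <;>
    generalize θ p.b = B <;>
    generalize θ p.c = C <;>
    clear hx hy hz hmap hcube <;>
    grind (ringSteps := 100000)

end Coordinates

/-! ### The involutions σ, τ, τ^σ, ι and their fixed points. -/

section Involutions

variable {K : Type*} [Field K] {θ : K →+* K}

/-- Right multiplication reverses products. -/
lemma transl_mul (ξ ξ' : Xi θ) : transl (ξ * ξ') = transl ξ' * transl ξ := by
  ext1 p
  rcases p with _ | x
  · rfl
  · exact congrArg some (mul_assoc x ξ ξ').symm

lemma transl_one : transl (1 : Xi θ) = 1 := by
  ext1 p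
  rcases p with _ | x
  · rfl
  · exact congrArg some (mul_one x)

lemma transl_inv (ξ : Xi θ) : (transl ξ)⁻¹ = transl ξ⁻¹ := by
  rw [inv_eq_iff_mul_eq_one, ← transl_mul, inv_mul_cancel, transl_one]

lemma sigma_some (x : Xi θ) : sigma θ (some x) = some ⟨-x.a, x.b, -x.c⟩ := by
  have : sigma θ (some x) =
    some ⟨((-1 : Kˣ) : K) * x.a, θ ((-1 : Kˣ) : K) * ((-1 : Kˣ) : K) * x.b,
      θ ((-1 : Kˣ) : K) * ((-1 : Kˣ) : K) ^ 2 * x.c⟩ := rfl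
  rw [this]
  simp

lemma sigma_none : sigma θ none = none := rfl

lemma tau_some (x : Xi θ) : tau θ (some x) = some ⟨-x.a, x.b, 1 - x.c⟩ := by
  rw [tau, Equiv.Perm.mul_apply, sigma_some, transl_some, Xi.mul_def, zeta]
  simp only [map_zero]
  congr 2 <;> ring

lemma tau_none : tau θ none = none := rfl

lemma mul_self_tau : tau θ * tau θ = 1 := by
  ext1 p
  rcases p with _ | x
  · rfl
  · simp [Equiv.Perm.mul_apply, tau_some]

lemma fix_conjBy {P : Type*} (g h : Equiv.Perm P) : Fix (conjBy g h) = h '' Fix g := by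
  ext p
  rw [Equiv.image_eq_preimage_symm]
  change h (g (h⁻¹ p)) = p ↔ g (h⁻¹ p) = h⁻¹ p
  rw [← Equiv.Perm.eq_inv_iff_eq (f := h)]

lemma orderOf_conjBy {P : Type*} (g h : Equiv.Perm P) : orderOf (conjBy g h) = orderOf g := by
  rw [conjBy, ← MulAut.conj_apply]
  exact MulEquiv.orderOf_eq _ _

variable [CharP K 3]

lemma three_eq_zero (K : Type*) [Field K] [CharP K 3] : (3 : K) = 0 := by
  exact_mod_cast CharP.cast_eq_zero K 3

lemma eq_zero_of_neg_eq {t : K} (h : -t = t) : t = 0 := by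
  have := three_eq_zero K
  grind

lemma fix_sigma : Fix (sigma θ) = insert none (Set.range fun b => some ⟨0, b, 0⟩) := by
  ext p
  rcases p with _ | ⟨a, b, c⟩
  · simp [Fix, Function.fixedPoints, Function.IsFixedPt, sigma_none]
  · simp only [Fix, Function.fixedPoints, Function.IsFixedPt, Set.mem_ofPred_eq, sigma_some,
      Option.some.injEq, Xi.mk.injEq, true_and, Set.mem_insert_iff, reduceCtorEq, false_or,
      Set.mem_range]
    constructor
    · rintro ⟨h1, h2⟩
      exact ⟨b, (eq_zero_of_neg_eq h1).symm, rfl, (eq_zero_of_neg_eq h2).symm⟩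
    · rintro ⟨y, rfl, rfl, rfl⟩
      simp

lemma fix_tau : Fix (tau θ) = insert none (Set.range fun b => some ⟨0, b, -1⟩) := by
  have h3 := three_eq_zero K
  ext p
  rcases p with _ | ⟨a, b, c⟩
  · simp [Fix, Function.fixedPoints, Function.IsFixedPt, tau_none]
  · simp only [Fix, Function.fixedPoints, Function.IsFixedPt, Set.mem_ofPred_eq, tau_some,
      Option.some.injEq, Xi.mk.injEq, true_and, Set.mem_insert_iff, reduceCtorEq, false_or,
      Set.mem_range]
    constructor
    · rintro ⟨h1, h2⟩
      exact ⟨b, (eq_zero_of_neg_eq h1).symm, rfl, by grind⟩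
    · rintro ⟨y, rfl, rfl, rfl⟩
      grind

lemma fix_tauSigma : Fix (tauSigma θ) = insert none (Set.range fun b => some ⟨0, b, 1⟩) := by
  rw [tauSigma, fix_conjBy, fix_tau, Set.image_insert_eq, sigma_none, ← Set.range_comp]
  congr 1
  refine congrArg Set.range (funext fun b => ?_)
  simp [sigma_some]

omit [CharP K 3] in
lemma transl_lam_some (t : K) (x : Xi θ) :
    transl (lam θ t) (some x) = some ⟨x.a, x.b + t, x.c + x.a * t⟩ := by
  rw [transl_some, Xi.mul_def, lam]
  simp only [map_zero]
  congr 2 <;> ring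

omit [CharP K 3] in
lemma lam_mul (s t : K) : lam θ s * lam θ t = lam θ (s + t) := by
  rw [Xi.mul_def, lam, lam, lam]
  simp

omit [CharP K 3] in
-- For c = 0, -1, 1 these sets are the fixed point sets of σ, τ, τ^σ. Since a = 0 on them, λ_t
-- merely shifts b.
lemma transl_lam_image (t c : K) :
    transl (lam θ t) '' insert none (Set.range fun b => some ⟨0, b, c⟩) =
      insert none (Set.range fun b => some ⟨0, b, c⟩) := by
  rw [Set.image_insert_eq, transl_none, ← Set.range_comp]
  congr 1
  rw [← (Equiv.addRight t).surjective.range_comp fun b => (some ⟨0, b, c⟩ : Point θ)]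
  congr 1
  ext1 b
  simp [transl_lam_some]

lemma fix_tau_inter_fix_tauSigma : Fix (tau θ) ∩ Fix (tauSigma θ) = {none} := by
  have h3 := three_eq_zero K
  rw [fix_tau, fix_tauSigma]
  ext p
  rcases p with _ | ⟨a, b, c⟩
  · simp
  · simp only [Set.mem_inter_iff, Set.mem_insert_iff, reduceCtorEq, Set.mem_range,
      Option.some.injEq, Xi.mk.injEq, false_or, Set.mem_singleton_iff, iff_false, not_and]
    rintro ⟨_, _, _, h⟩ ⟨_, _, _, h'⟩
    have : (1 : K) ≠ 0 := one_ne_zero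
    grind

lemma sigma_isInducedBy : IsInducedBy (sigma θ)
    -- The overall sign is chosen so that this equals the matrix product in `sigma_eq` exactly, not
    -- only up to a scalar.
    (Matrix.diagonal ![-1, 1, -1, 1, -1, 1, -1]) := by
  rintro (_ | x)
  · refine ⟨-1, by simp, ?_⟩
    rw [sigma_none]
    ext i
    fin_cases i <;> simp [liftMatrix, coords, Matrix.diagonal_map, Matrix.mulVec_diagonal]
  · refine ⟨-1, by simp, ?_⟩
    rw [sigma_some]
    ext i
    fin_cases i <;> simp [liftMatrix, coords, Matrix.diagonal_map, Matrix.mulVec_diagonal,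
      Xi.u, Xi.v, Xi.N] <;> ring

/-- The group is generated by `ω` and Ξ alone, so membership of `σ` needs an explicit word; it is
verified on matrices over F_3. -/
lemma sigma_eq (hθ : IsTits θ) : sigma θ =
    transl ⟨1, 1, 0⟩ * (omega hθ * (transl ⟨1, -1, 0⟩ * (omega hθ *
      (transl ⟨1, 0, 0⟩ * omega hθ)))) := by
  have h (x y z : ZMod 3) := transl_isInducedBy (θ := θ) x y z
  have h1 := h 1 1 0
  have h2 := h 1 (-1) 0
  have h3 := h 1 0 0
  have hω := omega_isInducedBy hθ
  simp only [map_one, map_zero, map_neg] at h1 h2 h3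
  have key := h1.mul (hω.mul (h2.mul (hω.mul (h3.mul hω))))
  refine sigma_isInducedBy.unique ?_
  rwa [show (Matrix.diagonal ![-1, 1, -1, 1, -1, 1, -1] : Matrix (Fin 7) (Fin 7) (ZMod 3)) =
    translMatrix 1 1 0 * (omegaMatrix * (translMatrix 1 (-1) 0 * (omegaMatrix *
      (translMatrix 1 0 0 * omegaMatrix)))) by decide +kernel]

lemma omega_mem (hθ : IsTits θ) : omega hθ ∈ Ree hθ :=
  Subgroup.subset_closure (Or.inl rfl)

lemma transl_mem (hθ : IsTits θ) (ξ : Xi θ) : transl ξ ∈ Ree hθ :=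
  Subgroup.subset_closure (Or.inr ⟨ξ, rfl⟩)

lemma sigma_mem (hθ : IsTits θ) : sigma θ ∈ Ree hθ := by
  rw [sigma_eq hθ]
  have hω := omega_mem hθ
  have h := transl_mem hθ
  exact mul_mem (h _) (mul_mem hω (mul_mem (h _) (mul_mem hω (mul_mem (h _) hω))))

lemma tau_mem (hθ : IsTits θ) : tau θ ∈ Ree hθ :=
  mul_mem (transl_mem hθ _) (sigma_mem hθ)

lemma image_mem_unitalBlocks (hθ : IsTits θ) {g : Equiv.Perm (Point θ)} (hg : g ∈ Ree hθ)
    {B : Set (Point θ)} (hB : B ∈ unitalBlocks hθ) : g '' B ∈ unitalBlocks hθ := by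
  obtain ⟨hne, h, hh, ho, rfl⟩ := hB
  exact ⟨hne.image _, conjBy h g, mul_mem (mul_mem hg hh) (inv_mem hg),
    by rw [orderOf_conjBy, ho], (fix_conjBy h g).symm⟩

lemma mul_self_omega (hθ : IsTits θ) : omega hθ * omega hθ = 1 :=
  Equiv.ext (omegaFun_involutive hθ)

lemma iota_eq_conjBy (hθ : IsTits θ) :
    iota hθ = conjBy (omega hθ) (transl (alpha θ) * omega hθ)⁻¹ := by
  rw [iota, conjBy, inv_inv]

lemma orderOf_omega (hθ : IsTits θ) : orderOf (omega hθ) = 2 := by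
  refine orderOf_eq_prime (by rw [pow_two, mul_self_omega]) fun h => ?_
  have := Equiv.ext_iff.1 h none
  exact absurd this (by rw [show omega hθ none = some 1 from rfl]; simp)

lemma fix_tau_mem (hθ : IsTits θ) : Fix (tau θ) ∈ unitalBlocks hθ := by
  refine ⟨⟨none, tau_none⟩, tau θ, tau_mem hθ, orderOf_eq_prime (by rw [pow_two, mul_self_tau])
    fun h => ?_, rfl⟩
  have := Equiv.ext_iff.1 h (some 1)
  rw [tau_some] at this
  simp [Xi.one_def] at this

lemma fix_tauSigma_mem (hθ : IsTits θ) : Fix (tauSigma θ) ∈ unitalBlocks hθ := by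
  rw [tauSigma, fix_conjBy]
  exact image_mem_unitalBlocks hθ (sigma_mem hθ) (fix_tau_mem hθ)

/-- The matrix inducing `ι`. -/
def iotaMatrix : Matrix (Fin 7) (Fin 7) (ZMod 3) :=
  !![1, 1, 1, -1, 0, 1, -1; -1, 0, 0, 1, -1, 0, -1; 1, 0, 1, 0, 0, -1, 0;
    1, 1, -1, 1, 0, -1, -1; -1, 1, 0, 1, 1, 0, -1; -1, 1, 1, -1, 0, 0, -1;
    1, 1, 1, 1, -1, 1, 1]

lemma isInducedBy_iota (hθ : IsTits θ) : IsInducedBy (iota hθ) iotaMatrix := by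
  have h (x y z : ZMod 3) := transl_isInducedBy (θ := θ) x y z
  have h1 := h (-1) 0 1
  have h2 := h 1 1 (-1)
  have hω := omega_isInducedBy hθ
  simp only [map_one, map_zero, map_neg] at h1 h2
  have key := hω.mul (h2.mul (hω.mul (h1.mul hω)))
  have hα : (alpha θ)⁻¹ = ⟨1, 1, -1⟩ := by simp [alpha, Xi.inv_def]
  have e : iota hθ = omega hθ * (transl ⟨1, 1, -1⟩ *
      (omega hθ * (transl (alpha θ) * omega hθ))) := by
    have hω' : (omega hθ)⁻¹ = omega hθ := inv_eq_of_mul_eq_one_left (mul_self_omega hθ)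
    rw [iota, mul_inv_rev, transl_inv, hα, hω', mul_assoc, mul_assoc]
  rw [e]
  rwa [show iotaMatrix = omegaMatrix * (translMatrix 1 1 (-1) * (omegaMatrix *
    (translMatrix (-1) 0 1 * omegaMatrix))) by decide +kernel]

lemma mem_fix_iota_iff (hθ : IsTits θ) (x : Xi θ) : some x ∈ Fix (iota hθ) ↔ ∃ k : K, k ≠ 0 ∧
    1 + x.a + x.b - x.c + x.v - x.N = k ∧
    -1 + x.c - x.u - x.N = k * x.a ∧
    1 + x.b - x.v = k * x.b ∧
    1 + x.a - x.b + x.c - x.v - x.N = k * x.c ∧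
    -1 + x.a + x.c + x.u - x.N = k * x.u ∧
    -1 + x.a + x.b - x.c - x.N = k * x.v ∧
    1 + x.a + x.b + x.c - x.u + x.v + x.N = k * x.N := by
  rw [(isInducedBy_iota hθ).mem_fix_iff]
  refine exists_congr fun k => and_congr_right fun _ => ?_
  rw [funext_iff]
  simp only [Fin.forall_fin_succ, liftMatrix, iotaMatrix, coords, Matrix.mulVec, dotProduct,
    Fin.sum_univ_succ]
  simp [sub_eq_add_neg, add_assoc]

lemma none_notMem_fix_iota (hθ : IsTits θ) : none ∉ Fix (iota hθ) := by
  rw [(isInducedBy_iota hθ).mem_fix_iff]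
  rintro ⟨k, -, h⟩
  -- The matrix moves ∞ to a vector with coordinate 0 equal to -1, whereas that coordinate of ∞
  -- vanishes.
  have := congrFun h 0
  simp [liftMatrix, iotaMatrix, coords, Matrix.mulVec, dotProduct, Fin.sum_univ_succ] at this

lemma mem_fix_iota_iff₁ (hθ : IsTits θ) (s : K) :
    some ⟨0, s, -1⟩ ∈ Fix (iota hθ) ↔ s = 0 := by
  have h3 := three_eq_zero K
  have : (1 : K) ≠ 0 := one_ne_zero
  rw [mem_fix_iota_iff]
  simp only [Xi.u, Xi.v, Xi.N, map_zero, map_neg, map_one]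
  constructor
  · rintro ⟨k, hk, h⟩
    have := (map_eq_zero θ (a := s)).1
    grind
  · rintro rfl
    refine ⟨-1, by simp, ?_⟩
    simp only [map_zero]
    grind

lemma mem_fix_iota_iff₂ (hθ : IsTits θ) (s : K) :
    some ⟨0, s, 1⟩ ∈ Fix (iota hθ) ↔ s = 1 := by
  have h3 := three_eq_zero K
  have : (1 : K) ≠ 0 := one_ne_zero
  rw [mem_fix_iota_iff]
  simp only [Xi.u, Xi.v, Xi.N, map_zero, map_one]
  constructor
  · rintro ⟨k, hk, h⟩
    grind
  · rintro rfl
    refine ⟨-1, by simp, ?_⟩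
    simp only [map_one]
    grind

lemma mem_fix_iota_iff₃ (hθ : IsTits θ) (s : K) :
    some ⟨-1, s - 1, 1 - s⟩ ∈ Fix (iota hθ) ↔ s = 0 ∨ s = 1 := by
  have h3 := three_eq_zero K
  have : (1 : K) ≠ 0 := one_ne_zero
  rw [mem_fix_iota_iff]
  simp only [Xi.u, Xi.v, Xi.N, map_sub, map_neg, map_one]
  constructor
  · rintro ⟨k, hk, h⟩
    -- With b = s - 1, the rows of b and c force k = -1 and b(b + 1) = 0.
    grind
  · rintro (rfl | rfl)
    · refine ⟨-1, by simp, ?_⟩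
      simp only [map_zero]
      grind
    · refine ⟨-1, by simp, ?_⟩
      simp only [map_one]
      grind

lemma fix_iota_mem (hθ : IsTits θ) : Fix (iota hθ) ∈ unitalBlocks hθ := by
  refine ⟨⟨_, (mem_fix_iota_iff₁ hθ 0).2 rfl⟩, iota hθ, ?_, ?_, rfl⟩
  · have h := mul_mem (transl_mem hθ (alpha θ)) (omega_mem hθ)
    exact mul_mem (mul_mem (inv_mem h) (omega_mem hθ)) h
  · rw [iota_eq_conjBy, orderOf_conjBy, orderOf_omega]

end Involutions

/-! ### Recognising the dual of K_5. -/

section Configurations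

/-- Five sets and ten points `T i j`, `i < j`, such that `T i j` lies on exactly the `i`-th and the
`j`-th set, form a super O'Nan configuration. -/
lemma isSuperONan_of_table {P : Type*} {𝓑 : Set (Set P)} {C : Config P} (B : Fin 5 → Set P)
    (T : Fin 5 → Fin 5 → P) (hB : ∀ k, B k ∈ 𝓑) (hblocks : C.blocks = Set.range B)
    (hpoints : C.points = {p | ∃ i j, i < j ∧ T i j = p})
    (h : ∀ i j, i < j → ∀ k, T i j ∈ B k ↔ k = i ∨ k = j) : IsSuperONan 𝓑 C := by
  obtain ⟨points, blocks⟩ := C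
  dsimp only at hblocks hpoints
  subst hblocks
  refine ⟨Set.range_subset_iff.2 hB, ?_⟩
  -- Only entries of `T` above the diagonal matter on edges; `min` and `max` make the table
  -- symmetric.
  let q : Sym2 (Fin 5) → P := Sym2.lift
    ⟨fun i j => T (min i j) (max i j), fun i j => by simp only [min_comm, max_comm]⟩
  have hq (i j : Fin 5) (hij : i ≠ j) (k : Fin 5) : q s(i, j) ∈ B k ↔ k ∈ s(i, j) := by
    rw [Sym2.mem_iff]
    change T (min i j) (max i j) ∈ B k ↔ _
    rcases hij.lt_or_gt with hlt | hlt
    · rw [← h i j hlt, min_eq_left hlt.le, max_eq_right hlt.le]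
    · rw [or_comm, ← h j i hlt, min_eq_right hlt.le, max_eq_left hlt.le]
  have hq' (e : (⊤ : SimpleGraph (Fin 5)).edgeSet) (k : Fin 5) :
      q e ∈ B k ↔ k ∈ (e : Sym2 (Fin 5)) := by
    obtain ⟨e, he⟩ := e
    induction e with
    | _ i j => exact hq i j (by simpa using he) k
  have hqinj : Function.Injective fun e : (⊤ : SimpleGraph (Fin 5)).edgeSet => q e := by
    intro e e' hee
    -- An edge is recovered from its point as the set of indices of the blocks through that point.
    refine Subtype.ext (Sym2.ext fun k => ?_)
    rw [← hq', ← hq']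
    exact iff_of_eq (congrArg (· ∈ B k) hee)
  have hBinj : Function.Injective B := by
    intro i j hij
    by_contra hne
    -- The point of the edge {i, k} lies on `B i` but not on `B j`.
    obtain ⟨k, hki, hkj⟩ : ∃ k, k ≠ i ∧ k ≠ j := by
      clear * -
      decide +revert
    have h1 := (hq i k hki.symm i).2 (by simp)
    rw [hij, hq i k hki.symm j] at h1
    simp [Ne.symm hne, hkj.symm] at h1
  have hrange : points = Set.range fun e : (⊤ : SimpleGraph (Fin 5)).edgeSet => q e := by
    rw [hpoints]
    ext p
    constructor
    · rintro ⟨i, j, hij, rfl⟩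
      refine ⟨⟨s(i, j), by simpa using hij.ne⟩, ?_⟩
      change T (min i j) (max i j) = _
      rw [min_eq_left hij.le, max_eq_right hij.le]
    · rintro ⟨⟨e, he⟩, rfl⟩
      induction e with
      | _ i j =>
        refine ⟨min i j, max i j, ?_, rfl⟩
        simpa [eq_comm] using he
  subst hrange
  refine ⟨(Equiv.ofInjective _ hqinj).symm, (Equiv.ofInjective _ hBinj).symm, ?_⟩
  rintro ⟨_, e, rfl⟩ ⟨_, k, rfl⟩
  rw [Equiv.ofInjective_symm_apply, Equiv.ofInjective_symm_apply]
  exact hq' e k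

/-! ### Translates of 𝒮, their incidences and the cosets of the prime field. -/

variable {K : Type*} [Field K] {θ : K →+* K}

/-- The images of the three points `ε`, `ε^σ` and `ψ` under `λ_s`. -/
def pearlPoint (θ : K →+* K) (s : K × Fin 3) : Point θ :=
  some (![⟨0, s.1, -1⟩, ⟨0, s.1, 1⟩, ⟨-1, s.1 - 1, 1 - s.1⟩] s.2)

lemma transl_pearlPoint (t s : K) (j : Fin 3) :
    transl (lam θ t) (pearlPoint θ (s, j)) = pearlPoint θ (s + t, j) := by
  fin_cases j <;> simp [pearlPoint, transl_lam_some] <;> ring_nf <;> trivial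

lemma transl_lam_add (s t : K) :
    transl (lam θ (s + t)) = transl (lam θ t) * transl (lam θ s) := by
  rw [← lam_mul, transl_mul]

lemma transl_lam_pow (n : ℕ) : transl (lam θ 1) ^ n = transl (lam θ n) := by
  induction n with
  | zero => rw [pow_zero, Nat.cast_zero]; exact transl_one.symm
  | succ n ih => rw [pow_succ', ih, Nat.cast_succ, transl_lam_add]

variable [CharP K 3]

lemma pearlPoint_injective : Function.Injective (pearlPoint θ) := by
  have h3 := three_eq_zero K
  have h1 : (1 : K) ≠ 0 := one_ne_zero
  rintro ⟨s, i⟩ ⟨t, j⟩ h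
  rw [pearlPoint, pearlPoint, Option.some.injEq] at h
  fin_cases i <;> fin_cases j <;> simp at h ⊢ <;> grind

/-- The block `Fix ι^(λ_s)`. -/
noncomputable def pearlBlock (hθ : IsTits θ) (s : K) : Set (Point θ) :=
  transl (lam θ s) '' Fix (iota hθ)

lemma pearlPoint_mem_pearlBlock (hθ : IsTits θ) (s t : K) (j : Fin 3) :
    pearlPoint θ (s, j) ∈ pearlBlock hθ t ↔ pearlPoint θ (s - t, j) ∈ Fix (iota hθ) := by
  rw [← sub_add_cancel s t, ← transl_pearlPoint, pearlBlock,
    (transl (lam θ t)).injective.mem_set_image, add_sub_cancel_right]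

lemma pearlPoint_zero_mem (hθ : IsTits θ) (s t : K) :
    pearlPoint θ (s, 0) ∈ pearlBlock hθ t ↔ s = t := by
  rw [pearlPoint_mem_pearlBlock, ← sub_eq_zero]
  exact mem_fix_iota_iff₁ hθ _

lemma pearlPoint_one_mem (hθ : IsTits θ) (s t : K) :
    pearlPoint θ (s, 1) ∈ pearlBlock hθ t ↔ s = t + 1 := by
  rw [pearlPoint_mem_pearlBlock, ← sub_eq_iff_eq_add']
  exact mem_fix_iota_iff₂ hθ _

lemma pearlPoint_two_mem (hθ : IsTits θ) (s t : K) :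
    pearlPoint θ (s, 2) ∈ pearlBlock hθ t ↔ s = t ∨ s = t + 1 := by
  rw [pearlPoint_mem_pearlBlock, ← sub_eq_iff_eq_add', ← sub_eq_zero (a := s)]
  exact mem_fix_iota_iff₃ hθ _

lemma none_notMem_pearlBlock (hθ : IsTits θ) (s : K) : none ∉ pearlBlock hθ s := by
  rw [pearlBlock, ← transl_none (lam θ s), (transl (lam θ s)).injective.mem_set_image]
  exact none_notMem_fix_iota hθ

lemma pearlBlock_injective (hθ : IsTits θ) : Function.Injective (pearlBlock hθ) := by
  intro s t h
  have := (pearlPoint_zero_mem hθ s s).2 rfl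
  rwa [h, pearlPoint_zero_mem] at this

lemma pearlBlock_mem (hθ : IsTits θ) (s : K) : pearlBlock hθ s ∈ unitalBlocks hθ :=
  image_mem_unitalBlocks hθ (transl_mem hθ _) (fix_iota_mem hθ)

omit [CharP K 3] in
lemma none_mem_fix_tau : none ∈ Fix (tau θ) := tau_none

omit [CharP K 3] in
lemma none_mem_fix_tauSigma : none ∈ Fix (tauSigma θ) := rfl

lemma pearlPoint_mem_fix_tau (s : K × Fin 3) : pearlPoint θ s ∈ Fix (tau θ) ↔ s.2 = 0 := by
  have h3 := three_eq_zero K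
  have h1 : (1 : K) ≠ 0 := one_ne_zero
  obtain ⟨s, j⟩ := s
  rw [fix_tau]
  fin_cases j <;> simp [pearlPoint] <;> grind

lemma pearlPoint_mem_fix_tauSigma (s : K × Fin 3) :
    pearlPoint θ s ∈ Fix (tauSigma θ) ↔ s.2 = 1 := by
  have h3 := three_eq_zero K
  have h1 : (1 : K) ≠ 0 := one_ne_zero
  obtain ⟨s, j⟩ := s
  rw [fix_tauSigma]
  fin_cases j <;> simp [pearlPoint] <;> grind

lemma fix_tau_ne_fix_tauSigma : Fix (tau θ) ≠ Fix (tauSigma θ) := by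
  intro h
  have := (pearlPoint_mem_fix_tau (θ := θ) (0, 0)).2 rfl
  rw [h, pearlPoint_mem_fix_tauSigma] at this
  exact absurd this zero_ne_one

/-- The union of the points and blocks belonging to the parameters in `S`, together with `∞`,
`Fix τ` and `Fix τ^σ`. -/
noncomputable def pearlOn (hθ : IsTits θ) (S : Set K) : Config (Point θ) where
  points := insert none (pearlPoint θ '' (S ×ˢ Set.univ))
  blocks := {Fix (tau θ), Fix (tauSigma θ)} ∪ pearlBlock hθ '' S

lemma mem_points_pearlOn (hθ : IsTits θ) (S : Set K) (p : Point θ) :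
    p ∈ (pearlOn hθ S).points ↔ p = none ∨ ∃ s ∈ S, pearlPoint θ (s, 0) = p ∨
      pearlPoint θ (s, 1) = p ∨ pearlPoint θ (s, 2) = p := by
  simp only [pearlOn, Set.mem_insert_iff, Set.mem_image, Prod.exists, Set.mem_prod, Set.mem_univ,
    and_true, exists_and_left, Fin.exists_fin_succ]
  simp

lemma pearl_map (hθ : IsTits θ) (t : K) :
    (pearl hθ).map (transl (lam θ t)) = pearlOn hθ {t, t + 1, t + 2} := by
  have e0 : eps θ = pearlPoint θ (0, 0) := by simp [eps, zeta, Xi.inv_def, pearlPoint]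
  have e1 : sigma θ (eps θ) = pearlPoint θ (0, 1) := by
    simp [eps, zeta, Xi.inv_def, pearlPoint, sigma_some]
  have e2 : psi θ = pearlPoint θ (0, 2) := by simp [psi, pearlPoint]
  have hb (s : K) : transl (lam θ t) '' (transl (lam θ s) '' Fix (iota hθ)) =
      pearlBlock hθ (s + t) := by
    rw [pearlBlock, transl_lam_add, Equiv.Perm.coe_mul, Set.image_comp]
  ext1
  · rw [Config.map, pearl, e1, e0, e2]
    simp only [transl_lam_pow, transl_pearlPoint, Set.image_union, Set.image_singleton,
      transl_none, ← Set.range_comp, Function.comp_def]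
    ext p
    simp [mem_points_pearlOn, Fin.exists_fin_succ, add_comm t, one_add_one_eq_two]
    tauto
  · rw [Config.map, pearl]
    simp only [transl_lam_pow, fix_conjBy, Set.image_union, Set.image_pair, ← Set.range_comp,
      Function.comp_def, hb, fix_tau, fix_tauSigma, transl_lam_image]
    rw [pearlOn, fix_tau, fix_tauSigma]
    congr 1
    ext p
    simp [Fin.exists_fin_succ, add_comm t, one_add_one_eq_two]

/-- The ψ-points join consecutive blocks, and t + 3 = t closes the three blocks to a triangle. The
ε-points join each of them to Fix τ, the ε^σ-points to Fix τ^σ, and ∞ is the remaining edge. -/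
lemma pearlOn_isSuperONan (hθ : IsTits θ) (t : K) :
    IsSuperONan (unitalBlocks hθ) (pearlOn hθ {t, t + 1, t + 2}) := by
  have h3 := three_eq_zero K
  have h1 : (1 : K) ≠ 0 := one_ne_zero
  refine isSuperONan_of_table
    ![Fix (tau θ), Fix (tauSigma θ), pearlBlock hθ t, pearlBlock hθ (t + 1),
      pearlBlock hθ (t + 2)]
    -- Entry (0, 1) is the genuine point ∞; on and below the diagonal `none` is only a filler.
    -- Entries (1, 4) and (2, 4) use that t is the successor of t + 2.
    ![![none, none, pearlPoint θ (t, 0), pearlPoint θ (t + 1, 0), pearlPoint θ (t + 2, 0)],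
      ![none, none, pearlPoint θ (t + 1, 1), pearlPoint θ (t + 2, 1), pearlPoint θ (t, 1)],
      ![none, none, none, pearlPoint θ (t + 1, 2), pearlPoint θ (t, 2)],
      ![none, none, none, none, pearlPoint θ (t + 2, 2)],
      fun _ => none] ?_ ?_ ?_ ?_
  · intro k
    fin_cases k
    exacts [fix_tau_mem hθ, fix_tauSigma_mem hθ, pearlBlock_mem hθ _, pearlBlock_mem hθ _,
      pearlBlock_mem hθ _]
  · ext B
    simp [pearlOn]
    grind
  · ext p
    simp [mem_points_pearlOn, Fin.exists_fin_succ]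
    grind
  · intro i j hij k
    fin_cases i <;> fin_cases j <;>
    first
    | exact absurd hij (by decide)
    | (fin_cases k <;>
      simp [none_mem_fix_tau, none_mem_fix_tauSigma, none_notMem_pearlBlock, pearlPoint_zero_mem,
        pearlPoint_one_mem, pearlPoint_two_mem, pearlPoint_mem_fix_tau,
        pearlPoint_mem_fix_tauSigma] <;> grind)

lemma none_mem_pearlOn (hθ : IsTits θ) (S : Set K) : none ∈ (pearlOn hθ S).points :=
  Set.mem_insert _ _

lemma pearlPoint_mem_pearlOn (hθ : IsTits θ) (S : Set K) (s : K × Fin 3) :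
    pearlPoint θ s ∈ (pearlOn hθ S).points ↔ s.1 ∈ S := by
  have : pearlPoint θ s ≠ none := Option.some_ne_none _
  rw [pearlOn, Set.mem_insert_iff, or_iff_right this, pearlPoint_injective.mem_set_image,
    Set.mem_prod, and_iff_left (Set.mem_univ _)]

lemma pearlOn_points_inter (hθ : IsTits θ) (S S' : Set K) :
    (pearlOn hθ S).points ∩ (pearlOn hθ S').points = (pearlOn hθ (S ∩ S')).points := by
  rw [pearlOn, pearlOn, pearlOn, ← Set.insert_inter_distrib,
    ← Set.image_inter pearlPoint_injective, Set.prod_inter_prod, Set.univ_inter]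

lemma pearlOn_blocks_inter (hθ : IsTits θ) (S S' : Set K) :
    (pearlOn hθ S).blocks ∩ (pearlOn hθ S').blocks = (pearlOn hθ (S ∩ S')).blocks := by
  rw [pearlOn, pearlOn, pearlOn, ← Set.union_inter_distrib_left,
    ← Set.image_inter (pearlBlock_injective hθ)]

lemma pearlOn_injective (hθ : IsTits θ) : Function.Injective (pearlOn hθ) := by
  intro S S' h
  ext s
  rw [← pearlPoint_mem_pearlOn hθ S (s, 0), h, pearlPoint_mem_pearlOn]

lemma ncard_points_pearlOn_univ [Finite K] (hθ : IsTits θ) :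
    (pearlOn hθ Set.univ).points.ncard = 3 * Nat.card K + 1 := by
  rw [pearlOn, Set.ncard_insert_of_notMem (by simp [pearlPoint]) (Set.toFinite _),
    Set.ncard_image_of_injective _ pearlPoint_injective, Set.univ_prod_univ, Set.ncard_univ,
    Nat.card_prod, Nat.card_fin, mul_comm]

lemma ncard_blocks_pearlOn_univ [Finite K] (hθ : IsTits θ) :
    (pearlOn hθ Set.univ).blocks.ncard = Nat.card K + 2 := by
  -- Incidence with ∞ distinguishes Fix τ and Fix τ^σ from all the other blocks.
  have hne {B : Set (Point θ)} (hB : none ∈ B) : B ∉ pearlBlock hθ '' Set.univ := by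
    rintro ⟨s, -, rfl⟩
    exact none_notMem_pearlBlock hθ s hB
  rw [pearlOn, Set.insert_union, Set.singleton_union, Set.ncard_insert_of_notMem,
    Set.ncard_insert_of_notMem (hne none_mem_fix_tauSigma) (Set.toFinite _),
    Set.ncard_image_of_injective _ (pearlBlock_injective hθ), Set.ncard_univ]
  · rw [Set.mem_insert_iff, not_or]
    exact ⟨fix_tau_ne_fix_tauSigma, hne none_mem_fix_tau⟩

/-- The prime field of `K`, as an additive subgroup. -/
def primeSubgroup (K : Type*) [Field K] [CharP K 3] : AddSubgroup K :=
  (ZMod.castHom (dvd_refl 3) K).toAddMonoidHom.range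

lemma mk_primeSubgroup : Cardinal.mk (primeSubgroup K) = 3 := by
  have : Nat.card (primeSubgroup K) = 3 := by
    rw [primeSubgroup, ← Nat.card_congr (AddMonoidHom.ofInjective
      (f := (ZMod.castHom (dvd_refl 3) K).toAddMonoidHom)
      (ZMod.castHom (dvd_refl 3) K).injective).toEquiv,
      Nat.card_zmod]
  have : Finite (primeSubgroup K) := Nat.finite_of_card_ne_zero (by omega)
  rw [← Nat.cast_card, ‹Nat.card _ = 3›, Nat.cast_ofNat]

lemma coset_eq (t : K) : ({t, t + 1, t + 2} : Set K) =
    (QuotientAddGroup.mk : K → K ⧸ primeSubgroup K) ⁻¹' {QuotientAddGroup.mk t} := by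
  ext s
  rw [Set.mem_preimage, Set.mem_singleton_iff, eq_comm, QuotientAddGroup.eq]
  have : -t + s ∈ primeSubgroup K ↔
      ∃ i : ZMod 3, ZMod.castHom (dvd_refl 3) K i = -t + s := Iff.rfl
  rw [this]
  have h : (∃ i : ZMod 3, ZMod.castHom (dvd_refl 3) K i = -t + s) ↔
      (ZMod.castHom (dvd_refl 3) K 0 = -t + s ∨ ZMod.castHom (dvd_refl 3) K 1 = -t + s ∨
        ZMod.castHom (dvd_refl 3) K 2 = -t + s) := by
    constructor
    · rintro ⟨i, hi⟩
      have : i = 0 ∨ i = 1 ∨ i = 2 := by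
        clear hi
        decide +revert
      rcases this with rfl | rfl | rfl
      exacts [Or.inl hi, Or.inr (Or.inl hi), Or.inr (Or.inr hi)]
    · rintro (h | h | h)
      exacts [⟨_, h⟩, ⟨_, h⟩, ⟨_, h⟩]
  rw [h, map_zero, map_one, map_ofNat]
  simp only [Set.mem_insert_iff, Set.mem_singleton_iff]
  grind

/-- The translates of the configuration, parametrized by the cosets of the prime field. -/
noncomputable def cosetPearl (hθ : IsTits θ) (q : K ⧸ primeSubgroup K) : Config (Point θ) :=
  pearlOn hθ (QuotientAddGroup.mk ⁻¹' {q})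

/-- The translate by λ_t involves exactly the parameters in t + F_3, hence depends only on that
coset. -/
lemma pearls_eq (hθ : IsTits θ) : pearls hθ = Set.range (cosetPearl hθ) := by
  rw [← (QuotientAddGroup.mk_surjective (s := primeSubgroup K)).range_comp]
  refine congrArg Set.range (funext fun t => ?_)
  rw [pearl_map, coset_eq]
  rfl

lemma cosetPearl_injective (hθ : IsTits θ) : Function.Injective (cosetPearl hθ) := by
  intro q r h
  have := Set.preimage_injective.2 QuotientAddGroup.mk_surjective (pearlOn_injective hθ h)
  exact Set.singleton_injective this

end Configurations

/-! ### Finite checks over F_3, unions and cardinalities. -/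

section Statement

lemma mem_fix_omega_iff {K : Type*} [Field K] [CharP K 3] {θ : K →+* K} (hθ : IsTits θ)
    (x : Xi θ) : some x ∈ Fix (omega hθ) ↔ ∃ k : K, k ≠ 0 ∧ x.N = k ∧ -x.v = k * x.a ∧
      -x.u = k * x.b ∧ -x.c = k * x.c ∧ -x.b = k * x.u ∧ -x.a = k * x.v ∧ 1 = k * x.N := by
  rw [(omega_isInducedBy hθ).mem_fix_iff]
  refine exists_congr fun k => and_congr_right fun _ => ?_
  rw [funext_iff]
  simp only [Fin.forall_fin_succ, liftMatrix, omegaMatrix, coords, Matrix.mulVec, dotProduct,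
    Fin.sum_univ_succ]
  simp

lemma none_notMem_fix_omega {K : Type*} [Field K] [CharP K 3] {θ : K →+* K} (hθ : IsTits θ) :
    none ∉ Fix (omega hθ) := Option.some_ne_none (1 : Xi θ)

lemma fix_omega_zmod : Fix (omega isTits_id) =
    {some ⟨0, 1, 1⟩, some ⟨0, 1, -1⟩, some ⟨1, 1, 0⟩, some ⟨-1, 1, 0⟩} := by
  ext p
  rcases p with _ | ⟨a, b, c⟩
  · simp [none_notMem_fix_omega]
  · simp only [mem_fix_omega_iff, Set.mem_insert_iff, Set.mem_singleton_iff, Option.some.injEq,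
      Xi.mk.injEq, Xi.u, Xi.v, Xi.N, RingHom.id_apply]
    -- Over F_3 this is a finite check over the 27 triples and the possible scalars k.
    decide +kernel +revert

lemma fix_iota_zmod : Fix (iota isTits_id) =
    {eps (RingHom.id (ZMod 3)), transl (lam _ 1) (sigma _ (eps _)), psi _,
      transl (lam _ 1) (psi _)} := by
  rw [eps, sigma_some, psi, transl_lam_some, transl_lam_some]
  ext p
  rcases p with _ | ⟨a, b, c⟩
  · simp [none_notMem_fix_iota]
  · simp only [mem_fix_iota_iff, Set.mem_insert_iff, Set.mem_singleton_iff, Option.some.injEq,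
      Xi.mk.injEq, Xi.inv_def, zeta, Xi.u, Xi.v, Xi.N, RingHom.id_apply]
    decide +kernel +revert

variable {K : Type*} [Field K] [CharP K 3] {θ : K →+* K}

lemma pearl_eq (hθ : IsTits θ) : pearl hθ = pearlOn hθ {0, 0 + 1, 0 + 2} := by
  rw [← pearl_map, show lam θ 0 = 1 from rfl, transl_one]
  simp [Config.map]

lemma iUnion_points_pearls (hθ : IsTits θ) :
    ⋃ C ∈ pearls hθ, C.points = (pearlOn hθ Set.univ).points := by
  ext p
  simp only [pearls_eq, Set.mem_iUnion, Set.exists_range_iff, exists_prop, cosetPearl,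
    mem_points_pearlOn, Set.mem_univ, true_and, Set.mem_preimage, Set.mem_singleton_iff]
  constructor
  · rintro ⟨q, h | ⟨s, -, h⟩⟩
    exacts [Or.inl h, Or.inr ⟨s, h⟩]
  · rintro (h | ⟨s, h⟩)
    exacts [⟨0, Or.inl h⟩, ⟨s, Or.inr ⟨s, rfl, h⟩⟩]

lemma iUnion_blocks_pearls (hθ : IsTits θ) :
    ⋃ C ∈ pearls hθ, C.blocks = (pearlOn hθ Set.univ).blocks := by
  ext B
  simp only [pearls_eq, Set.mem_iUnion, Set.exists_range_iff, exists_prop, cosetPearl,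
    pearlOn, Set.mem_union, Set.mem_image, Set.mem_univ, true_and, Set.mem_preimage,
    Set.mem_singleton_iff]
  constructor
  · rintro ⟨q, h | ⟨s, -, h⟩⟩
    exacts [Or.inl h, Or.inr ⟨s, h⟩]
  · rintro (h | ⟨s, h⟩)
    exacts [⟨0, Or.inl h⟩, ⟨s, Or.inr ⟨s, rfl, h⟩⟩]

/-- Translates correspond bijectively to cosets, and `K` is in bijection with (K/F_3) × F_3, also
when `K` is infinite. -/
lemma three_mul_mk_pearls (hθ : IsTits θ) :
    3 * Cardinal.mk (pearls hθ) = Cardinal.mk K := by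
  rw [pearls_eq, Cardinal.mk_range_eq _ (cosetPearl_injective hθ), mul_comm,
    ← mk_primeSubgroup (K := K), Cardinal.mul_def]
  exact (Cardinal.mk_congr AddSubgroup.addGroupEquivQuotientProdAddSubgroup).symm

/-- Different cosets are disjoint, so only the part belonging to the empty parameter set is shared.
-/
lemma cosetPearl_inter (hθ : IsTits θ) {q r : K ⧸ primeSubgroup K} (h : q ≠ r) :
    (cosetPearl hθ q).points ∩ (cosetPearl hθ r).points = {none} ∧
      (cosetPearl hθ q).blocks ∩ (cosetPearl hθ r).blocks =
        {Fix (tau θ), Fix (tauSigma θ)} := by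
  rw [cosetPearl, cosetPearl, pearlOn_points_inter, pearlOn_blocks_inter, ← Set.preimage_inter,
    Set.singleton_inter_eq_empty.2 (by simpa using h), Set.preimage_empty]
  simp [pearlOn]

end Statement

end ReeTits

open ReeTits in
theorem mainTheorem7 :
    -- the unital `RT(3)`
    (Fix (omega isTits_id) = {some ⟨0, 1, 1⟩, some ⟨0, 1, -1⟩, some ⟨1, 1, 0⟩, some ⟨-1, 1, 0⟩} ∧
      Fix (iota isTits_id) =
        {eps (RingHom.id (ZMod 3)), transl (lam _ 1) (sigma _ (eps _)), psi _,
          transl (lam _ 1) (psi _)} ∧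
      IsSuperONan (unitalBlocks isTits_id) (pearl isTits_id)) ∧
    -- the general Ree-Tits unital
    ∀ (K : Type*) [Field K] [CharP K 3] (θ : K →+* K) (hθ : IsTits θ),
      (eps θ ∈ Fix (iota hθ) ∧ transl (lam θ 1) (sigma θ (eps θ)) ∈ Fix (iota hθ)) ∧
      (∀ t : K,
        transl (lam θ t) '' Fix (sigma θ) = Fix (sigma θ) ∧
        transl (lam θ t) '' Fix (tau θ) = Fix (tau θ) ∧
        transl (lam θ t) '' Fix (tauSigma θ) = Fix (tauSigma θ)) ∧
      (∀ C ∈ pearls hθ, IsSuperONan (unitalBlocks hθ) C ∧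
        none ∈ C.points ∧ Fix (tau θ) ∈ C.blocks ∧ Fix (tauSigma θ) ∈ C.blocks) ∧
      Fix (tau θ) ∩ Fix (tauSigma θ) = {none} ∧
      (∀ C ∈ pearls hθ, ∀ C' ∈ pearls hθ, C ≠ C' →
        C.points ∩ C'.points = {none} ∧
        C.blocks ∩ C'.blocks = {Fix (tau θ), Fix (tauSigma θ)}) ∧
      3 * Cardinal.mk (pearls hθ) = Cardinal.mk K ∧
      (Finite K →
        (⋃ C ∈ pearls hθ, C.points).ncard = 3 * Nat.card K + 1 ∧
        (⋃ C ∈ pearls hθ, C.blocks).ncard = Nat.card K + 2) := by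
  refine ⟨⟨fix_omega_zmod, fix_iota_zmod, ?_⟩, ?_⟩
  · rw [pearl_eq]
    exact pearlOn_isSuperONan _ _
  intro K _ _ θ hθ
  refine ⟨⟨?_, ?_⟩, fun t => ⟨?_, ?_, ?_⟩, ?_, fix_tau_inter_fix_tauSigma, ?_,
    three_mul_mk_pearls hθ, fun _ => ⟨?_, ?_⟩⟩
  · rw [eps, Xi.inv_def, zeta]
    simp [mem_fix_iota_iff₁]
  · rw [eps, Xi.inv_def, zeta, sigma_some, transl_lam_some]
    simp [mem_fix_iota_iff₂]
  · rw [fix_sigma, transl_lam_image]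
  · rw [fix_tau, transl_lam_image]
  · rw [fix_tauSigma, transl_lam_image]
  · rintro _ ⟨t, rfl⟩
    dsimp only
    rw [pearl_map]
    refine ⟨pearlOn_isSuperONan hθ t, none_mem_pearlOn hθ _, ?_, ?_⟩ <;> simp [pearlOn]
  · rw [pearls_eq]
    rintro _ ⟨q, rfl⟩ _ ⟨r, rfl⟩ h
    exact cosetPearl_inter hθ fun hqr => h (congrArg _ hqr)
  · rw [iUnion_points_pearls, ncard_points_pearlOn_univ]
  · rw [iUnion_blocks_pearls, ncard_blocks_pearlOn_univ]
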